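/- For $\kappa\in\mathbb{R}$ write $\mathbb{C}_\kappa=\{s\in\mathbb{C}:\operatorname{Re}s>\kappa\}$. A complex-valued function $f$ defined on (a set containing) $\mathbb{C}_\kappa$ is called almost periodic on $\mathbb{C}_\kappa$ if it is bounded and uniformly continuous on $\mathbb{C}_\kappa$ and if, for every $\varepsilon>0$, the set of all $\tau\in\mathbb{R}$ with $|f(s+i\tau)-f(s)|\le\varepsilon$ for all $s\in\mathbb{C}_\kappa$ is relatively dense, i.e. there is a $d>0$ such that every closed interval of length $d$ in $\mathbb{R}$ contains an element of this set. Theorem. Let $\kappa\in\mathbb{R}$, and let $f$ be an analytic function on $\mathbb{C}_\kappa$ such that $f(\mathbb{C}_\kappa)\subseteq\mathbb{C}\setminus\{\alpha,\beta\}$ for some complex numbers $\alpha\neq\beta$. Suppose that $f$ is almost periodic on $\mathbb{C}_\theta$ for some $\theta>\kappa$. Then $f$ is almost periodic on $\mathbb{C}_\nu$ for all $\nu>\kappa$. -/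

import Mathlib

/-- The open half-plane `ℂ_κ = {s : Re s > κ}`. -/
def rightHalfPlane (κ : ℝ) : Set ℂ := {s : ℂ | κ < s.re}

/-- A set of reals is relatively dense if, for some `d > 0`, it meets every closed interval
of length `d`. -/
def IsRelativelyDense (A : Set ℝ) : Prop :=
  ∃ d : ℝ, 0 < d ∧ ∀ a : ℝ, (A ∩ Set.Icc a (a + d)).Nonempty

/-- The set `E_f(ε)` of `ε`-translation numbers of `f` on the half-plane `ℂ_κ`. -/
def translationNumbers (f : ℂ → ℂ) (κ ε : ℝ) : Set ℝ :=
  {τ : ℝ | ∀ s ∈ rightHalfPlane κ, ‖f (s + Complex.I * (τ : ℂ)) - f s‖ ≤ ε}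

/-- `f` is almost periodic on the half-plane `ℂ_κ`: it is bounded and uniformly continuous there,
and for every `ε > 0` its set of `ε`-translation numbers is relatively dense. -/
structure IsAlmostPeriodicOn (f : ℂ → ℂ) (κ : ℝ) : Prop where
  bounded : ∃ M : ℝ, ∀ s ∈ rightHalfPlane κ, ‖f s‖ ≤ M
  uniformContinuousOn : UniformContinuousOn f (rightHalfPlane κ)
  relativelyDense : ∀ ε : ℝ, 0 < ε → IsRelativelyDense (translationNumbers f κ ε)

/-! Boundedness of `f` spreads to the left, and the other two properties follow from it. Since `f`
omits two values, Schottky's theorem (`schottky`) on discs reaching the line Re s = κ carries a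
bound from `ℂ_θ` to `ℂ_μ` for any μ > κ (`exists_norm_le_of_mapsTo_compl_pair`). Take κ < μ < ν.
Cauchy's estimate then gives uniform continuity on `ℂ_ν`. If τ is a δ-translation number on `ℂ_θ`,
then f(s + iτ) - f(s) is bounded on `ℂ_μ` and at most δ on `ℂ_θ`; the three lines theorem makes it
at most ε on `ℂ_ν` once δ is small, independently of τ (`exists_translationNumbers_subset`).

Schottky's theorem comes from taking an arccosine twice: the resulting function omits a set that
meets every disc of radius 5, so the Bloch-type bound `norm_deriv_mul_le_of_image_no_ball` controls
its derivative. -/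

/-! ### Logarithms and arccosines on a disc -/

open Metric Set in
/-- A nonvanishing holomorphic function on a disc has a holomorphic logarithm. -/
theorem exists_differentiableOn_exp_eq_of_ball {f : ℂ → ℂ} {c : ℂ} {R : ℝ} (hR : 0 < R)
    (hf : DifferentiableOn ℂ f (ball c R)) (h0 : ∀ z ∈ ball c R, f z ≠ 0) :
    ∃ g : ℂ → ℂ, DifferentiableOn ℂ g (ball c R) ∧ ∀ z ∈ ball c R, Complex.exp (g z) = f z := by
  have hd : DifferentiableOn ℂ (fun z ↦ deriv f z / f z) (ball c R) :=
    (hf.deriv isOpen_ball).div hf h0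
  have hc : c ∈ ball c R := mem_ball_self hR
  obtain ⟨g, hgc, hg⟩ := hd.isExactOn_ball.with_val_at c (Complex.log (f c))
  have hgd : DifferentiableOn ℂ g (ball c R) := fun z hz ↦
    (hg z hz).differentiableAt.differentiableWithinAt
  refine ⟨g, hgd, fun z hz ↦ ?_⟩
  have key : ∀ w ∈ ball c R, HasDerivAt (fun w ↦ f w * Complex.exp (-g w)) 0 w := by
    intro w hw
    have h1 := (hf.differentiableAt (isOpen_ball.mem_nhds hw)).hasDerivAt
    have h2 := h1.mul (hg w hw).neg.cexp
    have e : deriv f w * Complex.exp (-g w) +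
        f w * (Complex.exp (-g w) * -(deriv f w / f w)) = 0 := by
      have := h0 w hw
      field_simp
      ring
    exact e ▸ h2
  have hconst : f z * Complex.exp (-g z) = f c * Complex.exp (-g c) :=
    (convex_ball c R).is_const_of_fderivWithin_eq_zero (𝕜 := ℂ)
      (f := fun w ↦ f w * Complex.exp (-g w))
      (fun w hw ↦ (key w hw).differentiableAt.differentiableWithinAt)
      (fun w hw ↦ by
        rw [fderivWithin_of_isOpen isOpen_ball hw]
        ext
        simpa using (key w hw).deriv) hz hc
  rw [hgc, Complex.exp_neg, Complex.exp_neg, Complex.exp_log (h0 c hc),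
    mul_inv_cancel₀ (h0 c hc), ← div_eq_mul_inv, div_eq_one_iff_eq (Complex.exp_ne_zero _)] at hconst
  exact hconst.symm

/-- |cos(x + iy)|² = cos² x + sinh² y, and |sinh y| ≥ |y|. This controls the imaginary part of an
arccosine. -/
theorem abs_im_le_norm_cos (w : ℂ) : |w.im| ≤ ‖Complex.cos w‖ := by
  have h1 : Real.sinh w.im ^ 2 ≤ ‖Complex.cos w‖ ^ 2 := by
    rw [← Complex.normSq_eq_norm_sq, Complex.cos_eq w, Complex.normSq_apply]
    simp only [← Complex.ofReal_cos, ← Complex.ofReal_cosh, ← Complex.ofReal_sin,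
      ← Complex.ofReal_sinh, ← Complex.ofReal_mul, Complex.sub_re, Complex.sub_im,
      Complex.ofReal_re, Complex.ofReal_im, Complex.re_ofReal_mul, Complex.im_ofReal_mul,
      Complex.I_re, Complex.I_im]
    nlinarith [Real.sin_sq_add_cos_sq w.re, Real.cosh_sq w.im, sq_nonneg (Real.cos w.re)]
  have h2 : |w.im| ≤ |Real.sinh w.im| := by
    rcases le_total 0 w.im with h | h
    · exact abs_le_abs_of_nonneg h (Real.self_le_sinh_iff.2 h)
    · exact abs_le_abs_of_nonpos h (Real.sinh_le_self_iff.2 h)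
  exact h2.trans (abs_le_of_sq_le_sq h1 (norm_nonneg _))

theorem norm_cos_le_exp_norm (w : ℂ) : ‖Complex.cos w‖ ≤ Real.exp ‖w‖ := by
  have h1 : ‖Complex.exp (w * Complex.I)‖ ≤ Real.exp ‖w‖ :=
    (Complex.norm_exp_le_exp_norm _).trans (by simp)
  have h2 : ‖Complex.exp (-w * Complex.I)‖ ≤ Real.exp ‖w‖ :=
    (Complex.norm_exp_le_exp_norm _).trans (by simp)
  rw [Complex.cos, norm_div, Complex.norm_ofNat]
  linarith [norm_add_le (Complex.exp (w * Complex.I)) (Complex.exp (-w * Complex.I))]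

open Metric Set in
/-- A holomorphic function on a disc that omits `1` and `-1` has a holomorphic arccosine, whose
value at the centre can be chosen bounded in terms of the value of the function there. -/
theorem exists_differentiableOn_cos_eq_of_ball {h : ℂ → ℂ} {c : ℂ} {R : ℝ} (hR : 0 < R)
    (hh : DifferentiableOn ℂ h (ball c R)) (h1 : ∀ z ∈ ball c R, h z ≠ 1)
    (h2 : ∀ z ∈ ball c R, h z ≠ -1) :
    ∃ F : ℂ → ℂ, DifferentiableOn ℂ F (ball c R) ∧ (∀ z ∈ ball c R, Complex.cos (F z) = h z) ∧
      ‖F c‖ ≤ Real.pi + ‖h c‖ := by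
  -- With q² = h² - 1, the factorization (h + q)(h - q) = 1 makes h + q zero-free; if h + q = exp m,
  -- then cos(-i m) = h.
  obtain ⟨l, hld, hl⟩ := exists_differentiableOn_exp_eq_of_ball hR
    (f := fun z ↦ h z ^ 2 - 1) ((hh.pow 2).sub_const 1) (fun z hz h0 ↦ by
      rcases sq_eq_sq_iff_eq_or_eq_neg.1 ((sub_eq_zero.1 h0).trans (one_pow 2).symm) with h | h
      exacts [h1 z hz h, h2 z hz h])
  set q : ℂ → ℂ := fun z ↦ Complex.exp (l z / 2) with hq
  have hqd : DifferentiableOn ℂ q (ball c R) := (hld.div_const 2).cexp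
  have hqs : ∀ z ∈ ball c R, q z ^ 2 = h z ^ 2 - 1 := fun z hz ↦ by
    rw [← hl z hz, hq, ← Complex.exp_nat_mul]
    congr 1
    push_cast
    ring
  obtain ⟨m, hmd, hm⟩ := exists_differentiableOn_exp_eq_of_ball hR (hh.add hqd) (fun z hz h0 ↦ by
    have h0' : h z + q z = 0 := h0
    have := hqs z hz
    rw [eq_neg_of_add_eq_zero_right h0'] at this
    exact one_ne_zero (α := ℂ) (by linear_combination this))
  have hm' : ∀ z ∈ ball c R, Complex.exp (m z) = h z + q z := hm
  -- Shifting by this period brings the real part at the centre into [-π, π].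
  set k : ℤ := round ((-Complex.I * m c).re / (2 * Real.pi)) with hk
  set F : ℂ → ℂ := fun z ↦ -Complex.I * m z - k * (2 * Real.pi) with hF
  have hcos : ∀ z ∈ ball c R, Complex.cos (F z) = h z := fun z hz ↦ by
    rw [hF]
    simp only
    rw [Complex.cos_sub_int_mul_two_pi, Complex.cos]
    have e1 : -Complex.I * m z * Complex.I = m z := by
      linear_combination (-m z) * Complex.I_mul_I
    have e2 : -(-Complex.I * m z) * Complex.I = -m z := by
      linear_combination (m z) * Complex.I_mul_I
    rw [e1, e2, Complex.exp_neg, hm' z hz]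
    have hne : h z + q z ≠ 0 := hm' z hz ▸ Complex.exp_ne_zero _
    have hinv : (h z + q z)⁻¹ = h z - q z := by
      refine inv_eq_of_mul_eq_one_right ?_
      linear_combination -hqs z hz
    rw [hinv]
    ring
  refine ⟨F, (hmd.const_mul _).sub_const _, hcos, ?_⟩
  have hre : |(F c).re| ≤ Real.pi := by
    have e : (F c).re = 2 * Real.pi * ((-Complex.I * m c).re / (2 * Real.pi) - k) := by
      have : (F c).re = (-Complex.I * m c).re - k * (2 * Real.pi) := by
        simp [hF, Complex.sub_re, Complex.mul_re]
      rw [this]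
      field_simp
    rw [e, abs_mul, abs_of_pos Real.two_pi_pos]
    nlinarith [abs_sub_round ((-Complex.I * m c).re / (2 * Real.pi)), Real.pi_pos]
  have him := abs_im_le_norm_cos (F c)
  rw [hcos c (mem_ball_self hR)] at him
  linarith [Complex.norm_le_abs_re_add_abs_im (F c)]

/-! ### The theorems of Bloch and Schottky -/

/-- The set of points where the cosine takes an integer value meets every disc of radius `5`. -/
theorem exists_cos_eq_intCast_dist_lt (w : ℂ) :
    ∃ w' : ℂ, dist w' w < 5 ∧ ∃ n : ℤ, Complex.cos w' = n := by
  -- The points used are kπ + iy' with cosh y' an integer, where the cosine is (-1)^k cosh y'. Each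
  -- coordinate can be matched to within 2.
  have hstep : ∀ y : ℝ, 0 ≤ y → ∃ y' : ℝ, y ≤ y' ∧ y' ≤ y + 2 ∧ ∃ n : ℤ, Real.cosh y' = n := by
    intro y hy
    have h2 : (2 : ℝ) ≤ Real.cosh 2 := by
      rw [Real.cosh_eq]
      have := Real.quadratic_le_exp_of_nonneg (x := 2) (by norm_num)
      linarith [Real.exp_pos (-2)]
    have h1 : Real.cosh y + 1 ≤ Real.cosh (y + 2) := by
      rw [Real.cosh_add]
      have := mul_nonneg (Real.sinh_nonneg_iff.2 hy) (Real.sinh_nonneg_iff.2 (zero_le_two (α := ℝ)))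
      nlinarith [Real.one_le_cosh y]
    obtain ⟨y', hy', he⟩ := intermediate_value_Icc (by linarith : y ≤ y + 2)
      Real.continuous_cosh.continuousOn
      (show ((⌈Real.cosh y⌉ : ℤ) : ℝ) ∈ Set.Icc (Real.cosh y) (Real.cosh (y + 2)) from
        ⟨Int.le_ceil _, (Int.ceil_lt_add_one _).le.trans h1⟩)
    exact ⟨y', hy'.1, hy'.2, _, he⟩
  have him : ∃ y' : ℝ, |y' - w.im| ≤ 2 ∧ ∃ n : ℤ, Real.cosh y' = n := by
    rcases le_total 0 w.im with h | h
    · obtain ⟨y', h1, h2, hn⟩ := hstep w.im h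
      exact ⟨y', abs_le.2 ⟨by linarith, by linarith⟩, hn⟩
    · obtain ⟨y', h1, h2, n, hn⟩ := hstep (-w.im) (by linarith)
      exact ⟨-y', abs_le.2 ⟨by linarith, by linarith⟩, n, by rw [Real.cosh_neg, hn]⟩
  obtain ⟨y', hy', n, hn⟩ := him
  set k : ℤ := round (w.re / Real.pi) with hk
  have hre : |k * Real.pi - w.re| ≤ 2 := by
    have e : k * Real.pi - w.re = -(Real.pi * (w.re / Real.pi - k)) := by
      have := Real.pi_ne_zero
      field_simp
      ring
    rw [e, abs_neg, abs_mul, abs_of_pos Real.pi_pos]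
    nlinarith [abs_sub_round (w.re / Real.pi), Real.pi_pos, Real.pi_le_four]
  refine ⟨((k * Real.pi : ℝ) : ℂ) + y' * Complex.I, ?_, (-1) ^ k.natAbs * n, ?_⟩
  · rw [dist_eq_norm]
    refine (Complex.norm_le_abs_re_add_abs_im _).trans_lt ?_
    have e1 : (((k * Real.pi : ℝ) : ℂ) + y' * Complex.I - w).re = k * Real.pi - w.re := by
      simp
    have e2 : (((k * Real.pi : ℝ) : ℂ) + y' * Complex.I - w).im = y' - w.im := by
      simp
    rw [e1, e2]
    linarith
  · rw [Complex.cos_add_mul_I, ← Complex.ofReal_sin, Real.sin_int_mul_pi, ← Complex.ofReal_cos,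
      Real.cos_int_mul_pi, ← Complex.ofReal_cosh, hn]
    rcases Int.even_or_odd k with h | h
    · simp [h.neg_one_zpow, (Int.natAbs_even.2 h).neg_one_pow]
    · simp [h.neg_one_zpow, (Int.natAbs_odd.2 h).neg_one_pow]

open Metric Set in
/-- A weak form of **Bloch's theorem**: if the image of a disc under a holomorphic function
contains no disc of radius `B`, then the derivative at the centre is bounded. -/
theorem norm_deriv_mul_le_of_image_no_ball {g : ℂ → ℂ} {c : ℂ} {R B : ℝ} (hR : 0 < R) (hB : 0 < B)
    (hg : DifferentiableOn ℂ g (ball c R))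
    (hno : ∀ w : ℂ, ∃ w' ∈ ball w B, w' ∉ g '' ball c R) :
    ‖deriv g c‖ * R ≤ 96 * B := by
  set r := R / 2 with hr
  have hr0 : 0 < r := half_pos hR
  have hrR : closedBall c r ⊆ ball c R := closedBall_subset_ball (half_lt_self hR)
  have hg' : DifferentiableOn ℂ (deriv g) (ball c R) := hg.deriv isOpen_ball
  -- Weighting by the distance to the boundary ensures that |g'| ≤ 2|g'(p)| on the disc about the
  -- maximum point p reaching halfway to the boundary.
  obtain ⟨p, hp, hmax⟩ := (isCompact_closedBall c r).exists_isMaxOn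
    ⟨c, mem_closedBall_self hr0.le⟩
    (f := fun z ↦ ‖deriv g z‖ * (r - dist z c))
    ((hg'.continuousOn.mono hrR).norm.mul (by fun_prop))
  have hpc : ‖deriv g c‖ * r ≤ ‖deriv g p‖ * (r - dist p c) := by
    simpa using hmax (mem_closedBall_self hr0.le)
  set A := ‖deriv g p‖ with hA
  have hA0 : 0 ≤ A := norm_nonneg _
  set t := (r - dist p c) / 2 with ht
  have hpr : dist p c ≤ r := hp
  suffices h : A * t ≤ 24 * B by
    have e : A * (r - dist p c) = 2 * (A * t) := by rw [ht]; ring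
    have e' : ‖deriv g c‖ * R = 2 * (‖deriv g c‖ * r) := by rw [hr]; ring
    linarith
  by_contra! hlt
  have hAt : 0 < A * t := by linarith
  have ht0 : 0 < t := by
    have : 0 ≤ t := by rw [ht]; linarith
    rcases this.eq_or_lt with h | h
    · rw [← h] at hAt; simp at hAt
    · exact h
  have hApos : 0 < A := pos_of_mul_pos_left hAt ht0.le
  have hsub : ball p t ⊆ closedBall c r := fun z hz ↦ by
    have : dist z p < t := hz
    rw [mem_closedBall]
    linarith [dist_triangle z p c, ht]
  have hbd : ∀ z ∈ ball p t, ‖deriv g z‖ ≤ 2 * A := fun z hz ↦ by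
    have hzp : dist z p < t := hz
    have h1 : ‖deriv g z‖ * (r - dist z c) ≤ A * (r - dist p c) := hmax (hsub hz)
    have h2 : t ≤ r - dist z c := by linarith [dist_triangle z p c, ht]
    have h3 : ‖deriv g z‖ * t ≤ (2 * A) * t := by
      calc ‖deriv g z‖ * t ≤ ‖deriv g z‖ * (r - dist z c) := by gcongr
        _ ≤ A * (r - dist p c) := h1
        _ = 2 * A * t := by rw [ht]; ring
    exact le_of_mul_le_mul_right h3 ht0
  -- Schwarz's lemma for g' about p. On the circle of radius t/6 the linear part A t/6 then beats
  -- the error A t/12, so the image covers a disc of radius A t/24, which exceeds B.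
  have hder : ∀ z ∈ closedBall p (t / 6), ‖deriv g z - deriv g p‖ ≤ A / 2 := fun z hz ↦ by
    have hz6 : dist z p ≤ t / 6 := hz
    have h := Complex.dist_le_div_mul_dist_of_mapsTo_ball (R₂ := 3 * A)
      (hg'.mono (hsub.trans hrR)) (fun w hw ↦ by
        rw [mem_closedBall, dist_eq_norm]
        linarith [norm_sub_le (deriv g w) (deriv g p), hbd w hw])
      (show z ∈ ball p t by rw [mem_ball]; linarith)
    rw [dist_eq_norm] at h
    calc _ ≤ _ := h
      _ ≤ 3 * A / t * (t / 6) := by gcongr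
      _ = A / 2 := by field_simp; ring
  have hsub6 : closedBall p (t / 6) ⊆ ball c R :=
    ((closedBall_subset_ball (by linarith)).trans hsub).trans hrR
  have hsph : ∀ z ∈ sphere p (t / 6), A * t / 12 ≤ ‖g z - g p‖ := fun z hz ↦ by
    have hzp : ‖z - p‖ = t / 6 := by rw [← dist_eq_norm]; exact hz
    have h := (convex_closedBall p (t / 6)).norm_image_sub_le_of_norm_hasDerivWithin_le
      (f := fun z ↦ g z - deriv g p * z) (f' := fun z ↦ deriv g z - deriv g p)
      (fun x hx ↦ by
        have h1 := (hg.differentiableAt (isOpen_ball.mem_nhds (hsub6 hx))).hasDerivAt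
        have h2 := (hasDerivAt_id x).const_mul (deriv g p)
        rw [mul_one] at h2
        exact (h1.sub h2).hasDerivWithinAt)
      hder (mem_closedBall_self (by positivity)) (sphere_subset_closedBall hz)
    have e : deriv g p * (z - p) =
        (g z - g p) - ((g z - deriv g p * z) - (g p - deriv g p * p)) := by ring
    have h2 := norm_sub_le (g z - g p) ((g z - deriv g p * z) - (g p - deriv g p * p))
    rw [← e, norm_mul, hzp] at h2
    rw [hzp] at h
    change A * (t / 6) ≤ _ at h2
    linarith
  have hfreq : ∃ᶠ z in nhds p, g z ≠ g p := by
    have h1 := (hg.differentiableAt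
      (isOpen_ball.mem_nhds (hrR hp))).hasDerivAt.eventually_ne (c := g p) (norm_pos_iff.1 hApos)
    exact h1.frequently.filter_mono nhdsWithin_le_nhds
  have himg := DiffContOnCl.ball_subset_image_closedBall (f := g) (z₀ := p)
    ((hg.mono (closure_ball_subset_closedBall.trans hsub6)).diffContOnCl)
    (by positivity) hsph hfreq
  obtain ⟨w', hw', hn⟩ := hno (g p)
  exact hn (image_mono hsub6 (himg (ball_subset_ball (by linarith) hw')))

open Metric Set in
/-- **Schottky's theorem**, for functions that omit `1` and `-1`. -/
theorem schottky_of_ne_one_of_ne_neg_one (M : ℝ) : ∃ C : ℝ, ∀ (h : ℂ → ℂ) (c : ℂ) (R : ℝ), 0 < R →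
    DifferentiableOn ℂ h (ball c R) → (∀ z ∈ ball c R, h z ≠ 1) → (∀ z ∈ ball c R, h z ≠ -1) →
    ‖h c‖ ≤ M → ∀ z ∈ ball c (R / 2), ‖h z‖ ≤ C := by
  refine ⟨Real.exp (Real.pi * Real.exp (480 + (2 * Real.pi + M))),
    fun h c R hR hh h1 h2 hM z hz ↦ ?_⟩
  have hπ : (Real.pi : ℂ) ≠ 0 := Complex.ofReal_ne_zero.2 Real.pi_ne_zero
  obtain ⟨F, hFd, hF, hFc⟩ := exists_differentiableOn_cos_eq_of_ball hR hh h1 h2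
  have hFint : ∀ z ∈ ball c R, ∀ n : ℤ, F z / Real.pi ≠ n := fun z hz n hn ↦ by
    rw [div_eq_iff hπ] at hn
    have hc := hF z hz
    rw [hn, ← Complex.ofReal_intCast, ← Complex.ofReal_mul, ← Complex.ofReal_cos,
      Real.cos_int_mul_pi] at hc
    rcases Int.even_or_odd n with he | ho
    · rw [he.neg_one_zpow] at hc
      exact h1 z hz (by simpa using hc.symm)
    · rw [ho.neg_one_zpow] at hc
      exact h2 z hz (by simpa using hc.symm)
  -- F/π omits all integers, in particular ±1, so a second arccosine G exists, and G omits every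
  -- point with integer cosine.
  obtain ⟨G, hGd, hG, hGc⟩ := exists_differentiableOn_cos_eq_of_ball hR (hFd.div_const (Real.pi : ℂ))
    (fun z hz ↦ by simpa using hFint z hz 1) (fun z hz ↦ by simpa using hFint z hz (-1))
  have hGc' : ‖G c‖ ≤ 2 * Real.pi + M := by
    have : ‖F c / Real.pi‖ ≤ ‖F c‖ := by
      rw [norm_div, Complex.norm_real, Real.norm_of_nonneg Real.pi_pos.le]
      exact div_le_self (norm_nonneg _) (by linarith [Real.pi_gt_three])
    linarith
  have hderiv : ∀ w ∈ ball c (R / 2), ‖deriv G w‖ ≤ 960 / R := fun w hw ↦ by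
    have hsub : ball w (R / 2) ⊆ ball c R :=
      ball_subset_ball' (by linarith [mem_ball.1 hw])
    have := norm_deriv_mul_le_of_image_no_ball (B := 5) (half_pos hR) (by norm_num)
      (hGd.mono hsub) (fun v ↦ by
        obtain ⟨v', hv', n, hn⟩ := exists_cos_eq_intCast_dist_lt v
        refine ⟨v', hv', ?_⟩
        rintro ⟨x, hx, rfl⟩
        exact hFint x (hsub hx) n ((hG x (hsub hx)).symm.trans hn))
    rw [le_div_iff₀ hR]
    linarith
  have hhalf : ball c (R / 2) ⊆ ball c R := ball_subset_ball (by linarith)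
  have hGz : ‖G z‖ ≤ 480 + (2 * Real.pi + M) := by
    have h := (convex_ball c (R / 2)).norm_image_sub_le_of_norm_deriv_le
      (fun x hx ↦ hGd.differentiableAt (isOpen_ball.mem_nhds (hhalf hx))) hderiv
      (mem_ball_self (half_pos hR)) hz
    have hz' : ‖z - c‖ ≤ R / 2 := by rw [← dist_eq_norm]; exact (mem_ball.1 hz).le
    have h' : ‖G z - G c‖ ≤ 480 := by
      calc _ ≤ _ := h
        _ ≤ 960 / R * (R / 2) := by gcongr
        _ = 480 := by field_simp; norm_num
    linarith [norm_le_norm_sub_add (G z) (G c)]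
  have hFz : ‖F z‖ ≤ Real.pi * Real.exp (480 + (2 * Real.pi + M)) := by
    have h := norm_cos_le_exp_norm (G z)
    rw [hG z (hhalf hz), norm_div, Complex.norm_real, Real.norm_of_nonneg Real.pi_pos.le,
      div_le_iff₀ Real.pi_pos] at h
    rw [mul_comm]
    exact h.trans (by gcongr)
  rw [← hF z (hhalf hz)]
  exact (norm_cos_le_exp_norm _).trans (by gcongr)

open Metric Set in
/-- **Schottky's theorem**: a holomorphic function on a disc that omits two given values and is
bounded at the centre is bounded on the disc of half the radius. -/
theorem schottky {α β : ℂ} (hαβ : α ≠ β) (M : ℝ) : ∃ C : ℝ, ∀ (f : ℂ → ℂ) (c : ℂ) (R : ℝ), 0 < R →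
    DifferentiableOn ℂ f (ball c R) → MapsTo f (ball c R) {α, β}ᶜ →
    ‖f c‖ ≤ M → ∀ z ∈ ball c (R / 2), ‖f z‖ ≤ C := by
  have hne : β - α ≠ 0 := sub_ne_zero.2 hαβ.symm
  obtain ⟨C, hC⟩ := schottky_of_ne_one_of_ne_neg_one ((2 * M + ‖α + β‖) / ‖β - α‖)
  refine ⟨(C * ‖β - α‖ + ‖α + β‖) / 2, fun f c R hR hf hm hM z hz ↦ ?_⟩
  -- This affine map sends α to -1 and β to 1.
  have h := hC (fun z ↦ (2 * f z - (α + β)) / (β - α)) c R hR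
    (((hf.const_mul 2).sub_const _).div_const _)
    (fun w hw h1 ↦ hm hw (Or.inr (by
      rw [div_eq_one_iff_eq hne] at h1
      exact show f w = β by linear_combination h1 / 2)))
    (fun w hw h1 ↦ hm hw (Or.inl (by
      rw [div_eq_iff hne] at h1
      exact show f w = α by linear_combination h1 / 2)))
    (by
      rw [norm_div]
      gcongr
      refine (norm_sub_le _ _).trans ?_
      rw [norm_mul, Complex.norm_ofNat]
      linarith) z hz
  rw [norm_div, div_le_iff₀ (norm_pos_iff.2 hne)] at h
  have h3 := norm_le_norm_sub_add (2 * f z) (α + β)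
  rw [norm_mul, Complex.norm_ofNat] at h3
  linarith

/-! ### Extension of almost periodicity to larger half-planes -/

theorem isOpen_rightHalfPlane (κ : ℝ) : IsOpen (rightHalfPlane κ) :=
  isOpen_lt continuous_const Complex.continuous_re

theorem convex_rightHalfPlane (κ : ℝ) : Convex ℝ (rightHalfPlane κ) :=
  convex_halfSpace_re_gt κ

theorem rightHalfPlane_subset {κ ν : ℝ} (h : κ ≤ ν) : rightHalfPlane ν ⊆ rightHalfPlane κ :=
  fun _ hs ↦ lt_of_le_of_lt h hs

theorem ball_subset_rightHalfPlane {κ R : ℝ} {c : ℂ} (h : κ + R ≤ c.re) :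
    Metric.ball c R ⊆ rightHalfPlane κ := fun z hz ↦ by
  have h1 := (Complex.abs_re_le_norm (z - c)).trans_lt (by simpa [dist_eq_norm] using hz)
  rw [Complex.sub_re] at h1
  change κ < z.re
  linarith [(abs_lt.1 h1).1]

theorem add_I_mul_mem_rightHalfPlane {κ τ : ℝ} {s : ℂ} (hs : s ∈ rightHalfPlane κ) :
    s + Complex.I * (τ : ℂ) ∈ rightHalfPlane κ := by
  simpa [rightHalfPlane] using hs

/-- A holomorphic function on a half-plane that omits two values and is bounded on a smaller
half-plane is bounded on every smaller half-plane. -/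
theorem exists_norm_le_of_mapsTo_compl_pair {κ θ : ℝ} {f : ℂ → ℂ} {α β : ℂ} (hαβ : α ≠ β)
    (hf : DifferentiableOn ℂ f (rightHalfPlane κ))
    (hm : Set.MapsTo f (rightHalfPlane κ) {α, β}ᶜ) (hκθ : κ < θ)
    (hb : ∃ M : ℝ, ∀ s ∈ rightHalfPlane θ, ‖f s‖ ≤ M) {ν : ℝ} (hν : κ < ν) :
    ∃ M : ℝ, ∀ s ∈ rightHalfPlane ν, ‖f s‖ ≤ M := by
  have key : ∀ n : ℕ, ∃ M : ℝ, ∀ s ∈ rightHalfPlane (κ + (2 / 3) ^ n * (θ - κ)), ‖f s‖ ≤ M := by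
    intro n
    induction n with
    | zero => simpa using hb
    | succ n ih =>
      obtain ⟨M, hM⟩ := ih
      obtain ⟨C, hC⟩ := schottky hαβ M
      refine ⟨C, fun s hs ↦ ?_⟩
      have hs' : κ + (2 / 3) ^ (n + 1) * (θ - κ) < s.re := hs
      have hpos : 0 < (2 / 3 : ℝ) ^ n * (θ - κ) := by
        have := sub_pos.2 hκθ
        positivity
      rw [pow_succ] at hs'
      have hd : 0 < s.re - κ := by linarith
      -- With d = Re s - κ, the disc about s + x touching the line Re = κ has radius 5d/3. Its half
      -- radius 5d/6 exceeds x = 2d/3, and 5/3 · 2/3 > 1 puts the centre where `M` bounds f.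
      set x : ℝ := 2 / 3 * (s.re - κ) with hx
      have hre : (s + x).re = s.re + x := by simp
      have hsub : Metric.ball (s + x) (s.re + x - κ) ⊆ rightHalfPlane κ :=
        ball_subset_rightHalfPlane (by rw [hre]; linarith)
      refine hC f (s + x) (s.re + x - κ) (by linarith) (hf.mono hsub)
        (fun z hz ↦ hm (hsub hz)) (hM _ ?_) s ?_
      · change _ < (s + (x : ℂ)).re
        rw [hre]
        linarith
      · rw [Metric.mem_ball, dist_eq_norm, sub_add_cancel_left, norm_neg, Complex.norm_real,
          Real.norm_of_nonneg (by linarith)]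
        linarith
  have hθ := sub_pos.2 hκθ
  obtain ⟨n, hn⟩ := exists_pow_lt_of_lt_one (div_pos (sub_pos.2 hν) hθ)
    (by norm_num : (2 / 3 : ℝ) < 1)
  rw [lt_div_iff₀ hθ] at hn
  obtain ⟨M, hM⟩ := key n
  exact ⟨M, fun s hs ↦ hM s (rightHalfPlane_subset (by linarith) hs)⟩

/-- Cauchy's estimate on discs of radius ν - μ bounds f', so f is Lipschitz on the convex smaller
half-plane. -/
theorem uniformContinuousOn_rightHalfPlane_of_norm_le {μ ν M : ℝ} (hμν : μ < ν) {f : ℂ → ℂ}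
    (hf : DifferentiableOn ℂ f (rightHalfPlane μ)) (hM : ∀ s ∈ rightHalfPlane μ, ‖f s‖ ≤ M) :
    UniformContinuousOn f (rightHalfPlane ν) := by
  have hd : ∀ s ∈ rightHalfPlane ν, ‖deriv f s‖ ≤ M / (ν - μ) := fun s hs ↦ by
    have hs' : ν < s.re := hs
    have hsub : Metric.closedBall s (ν - μ) ⊆ rightHalfPlane μ :=
      (Metric.closedBall_subset_ball (by linarith : ν - μ < s.re - μ)).trans
        (ball_subset_rightHalfPlane (by linarith))
    exact Complex.norm_deriv_le_of_forall_mem_sphere_norm_le (sub_pos.2 hμν)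
      (hf.mono (Metric.closure_ball_subset_closedBall.trans hsub)).diffContOnCl
      fun z hz ↦ hM z (hsub (Metric.sphere_subset_closedBall hz))
  refine LipschitzOnWith.uniformContinuousOn (K := (M / (ν - μ)).toNNReal) ?_
  refine LipschitzOnWith.of_dist_le_mul fun x hx y hy ↦ ?_
  rw [dist_eq_norm, dist_eq_norm]
  refine (convex_rightHalfPlane ν).norm_image_sub_le_of_norm_deriv_le
    (fun z hz ↦ hf.differentiableAt
      ((isOpen_rightHalfPlane μ).mem_nhds (rightHalfPlane_subset hμν.le hz)))
    (fun z hz ↦ (hd z hz).trans (Real.le_coe_toNNReal _)) hy hx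

/-- For a bounded holomorphic function, translation numbers on a smaller half-plane are translation
numbers on a larger one, with a worse constant: a consequence of the three lines theorem. -/
theorem exists_translationNumbers_subset {μ ν θ M ε : ℝ} (hμν : μ < ν) (hνθ : ν < θ) (hε : 0 < ε)
    {f : ℂ → ℂ} (hf : DifferentiableOn ℂ f (rightHalfPlane μ))
    (hM : ∀ s ∈ rightHalfPlane μ, ‖f s‖ ≤ M) :
    ∃ δ : ℝ, 0 < δ ∧ translationNumbers f θ δ ⊆ translationNumbers f ν ε := by
  -- The half-planes are open, so the edges of the strip are moved strictly inside `ℂ_μ` and `ℂ_θ`.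
  set l := (μ + ν) / 2 with hl
  set u := θ + 1 with hu
  have hlν : l < ν := by linarith
  have hlu : l < u := by linarith
  have hul : 0 < u - l := sub_pos.2 hlu
  set t₀ := (ν - l) / (u - l) with ht₀
  have ht₀pos : 0 < t₀ := div_pos (sub_pos.2 hlν) hul
  have ht₀le : t₀ ≤ 1 := (div_le_one hul).2 (by linarith)
  -- Having a ≥ 1 and δ ≤ 1 makes a δ^t₀ a bound for the interpolated value at every abscissa from ν
  -- to θ; δ is chosen so that a δ^t₀ ≤ ε.
  set a := max 1 (2 * M) with ha
  have ha1 : 1 ≤ a := le_max_left _ _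
  have ha0 : 0 < a := by linarith
  set δ := min 1 ((ε / a) ^ (1 / t₀)) with hδ
  have hδ0 : 0 < δ := lt_min one_pos (Real.rpow_pos_of_pos (div_pos hε ha0) _)
  have hδ1 : δ ≤ 1 := min_le_left _ _
  have hδt : δ ^ t₀ ≤ ε / a := by
    calc δ ^ t₀ ≤ ((ε / a) ^ (1 / t₀)) ^ t₀ :=
          Real.rpow_le_rpow hδ0.le (min_le_right _ _) ht₀pos.le
      _ = ε / a := by
          rw [← Real.rpow_mul (by positivity), one_div_mul_cancel ht₀pos.ne', Real.rpow_one]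
  have hδε : δ ≤ ε := by
    calc δ = δ ^ (1 : ℝ) := (Real.rpow_one _).symm
      _ ≤ δ ^ t₀ := Real.rpow_le_rpow_of_exponent_ge hδ0 hδ1 ht₀le
      _ ≤ ε / a := hδt
      _ ≤ ε := div_le_self hε.le ha1
  refine ⟨δ, hδ0, fun τ hτ s hs ↦ ?_⟩
  have hs' : ν < s.re := hs
  by_cases hsu : θ < s.re
  · exact (hτ s hsu).trans hδε
  set g : ℂ → ℂ := fun s ↦ f (s + Complex.I * (τ : ℂ)) - f s with hg
  have hgd : DifferentiableOn ℂ g (rightHalfPlane μ) :=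
    (hf.comp (by fun_prop) fun z hz ↦ add_I_mul_mem_rightHalfPlane hz).sub hf
  have hga : ∀ z ∈ rightHalfPlane μ, ‖g z‖ ≤ a := fun z hz ↦ by
    refine (norm_sub_le _ _).trans (le_trans ?_ (le_max_right _ _))
    linarith [hM z hz, hM _ (add_I_mul_mem_rightHalfPlane (τ := τ) hz)]
  have hstrip : Complex.HadamardThreeLines.verticalClosedStrip l u ⊆ rightHalfPlane μ :=
    fun z hz ↦ lt_of_lt_of_le (by linarith : μ < l) hz.1
  have hcl : closure (Complex.HadamardThreeLines.verticalStrip l u) ⊆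
      Complex.HadamardThreeLines.verticalClosedStrip l u :=
    closure_minimal (Set.preimage_mono Set.Ioo_subset_Icc_self)
      (isClosed_Icc.preimage Complex.continuous_re)
  have h3 := Complex.HadamardThreeLines.norm_le_interp_of_mem_verticalClosedStrip' (f := g) (z := s)
    (a := a) (b := δ) hlu ⟨by linarith, by linarith⟩ (hgd.mono (hcl.trans hstrip)).diffContOnCl
    ⟨a, by
      rintro _ ⟨z, hz, rfl⟩
      exact hga z (hstrip hz)⟩
    (fun z hz ↦ hga z (hstrip ⟨hz.ge, hz.le.trans hlu.le⟩))
    (fun z hz ↦ hτ z (lt_of_lt_of_le (by linarith : θ < u) hz.ge))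
  set t := (s.re - l) / (u - l) with ht
  have htt : t₀ ≤ t := by rw [ht₀, ht]; gcongr
  calc ‖g s‖ ≤ a ^ (1 - t) * δ ^ t := h3
    _ ≤ a ^ (1 : ℝ) * δ ^ t₀ := by
        refine mul_le_mul (Real.rpow_le_rpow_of_exponent_le ha1 (by linarith))
          (Real.rpow_le_rpow_of_exponent_ge hδ0 hδ1 htt) (by positivity) (by positivity)
    _ ≤ a * (ε / a) := by rw [Real.rpow_one]; gcongr
    _ = ε := by field_simp

theorem IsRelativelyDense.mono {A B : Set ℝ} (hA : IsRelativelyDense A) (h : A ⊆ B) :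
    IsRelativelyDense B := by
  obtain ⟨d, hd, hA⟩ := hA
  exact ⟨d, hd, fun a ↦ (hA a).mono (Set.inter_subset_inter_left _ h)⟩

theorem mainTheorem11 (κ : ℝ) (f : ℂ → ℂ)
    (hf : AnalyticOnNhd ℂ f (rightHalfPlane κ))
    (hvals : ∃ α β : ℂ, α ≠ β ∧ Set.MapsTo f (rightHalfPlane κ) ({α, β}ᶜ : Set ℂ))
    (hap : ∃ θ : ℝ, κ < θ ∧ IsAlmostPeriodicOn f θ) :
    ∀ ν : ℝ, κ < ν → IsAlmostPeriodicOn f ν := by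
  intro ν hν
  obtain ⟨α, β, hαβ, hm⟩ := hvals
  obtain ⟨θ, hθ, hapθ⟩ := hap
  obtain ⟨μ, hκμ, hμν⟩ := exists_between hν
  obtain ⟨M, hM⟩ := exists_norm_le_of_mapsTo_compl_pair hαβ hf.differentiableOn hm hθ
    hapθ.bounded hκμ
  have hfμ : DifferentiableOn ℂ f (rightHalfPlane μ) :=
    hf.differentiableOn.mono (rightHalfPlane_subset hκμ.le)
  refine ⟨⟨M, fun s hs ↦ hM s (rightHalfPlane_subset hμν.le hs)⟩,
    uniformContinuousOn_rightHalfPlane_of_norm_le hμν hfμ hM, fun ε hε ↦ ?_⟩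
  -- The given θ need not exceed ν; enlarging it only weakens the condition on translation numbers.
  obtain ⟨δ, hδ, hsub⟩ := exists_translationNumbers_subset hμν
    (lt_max_of_lt_right (lt_add_one ν) : ν < max θ (ν + 1)) hε hfμ hM
  exact (hapθ.relativelyDense δ hδ).mono fun τ hτ ↦
    hsub fun s hs ↦ hτ s (rightHalfPlane_subset (le_max_left _ _) hs)
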